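/- **Finite-horizon ski rental.** Let $T\ge 1$ be an integer and let $B$ be a real number with $0<B\le T$. An adversary fixes in advance a sequence $\mathbf X=(X_1,\dots,X_T)\in\{0,1\}^T$ of bad ($0$) and good ($1$) days. On each day $i$ an online algorithm sees $X_i$ and then either stops, paying $B$ and nothing afterwards, or continues, paying $X_i$. A deterministic algorithm is a family of maps $(X_1,\dots,X_i)\mapsto\{\text{stop},\text{continue}\}$, $1\le i\le T$. A randomized algorithm $A$ is a probability distribution over deterministic algorithms, and $A(\mathbf X)$ is its expected cost. Let $\mathrm{OPT}(\mathbf X)=\min\{\sum_i X_i,B\}$ be the least cost of any algorithm on $\mathbf X$. Ratios are taken with $0/0=0$ and $c/0=\infty$ for $c>0$. The value of the game is $$\beta=\min_{A}\max_{\mathbf X\in\{0,1\}^T}\frac{A(\mathbf X)}{\mathrm{OPT}(\mathbf X)} ,$$ the minimum being over all randomized algorithms; an algorithm attaining it is called worst-case optimal. For $0\le l\le T$ let $A^l$ be the deterministic algorithm that ignores bad days, continues on the first $l$ good days and stops on the $(l+1)$-st good day. Let $\text{WC-OPT}$ be any worst-case optimal algorithm that is a randomization over $A^0,\dots,A^T$.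 Let $\text{SG-OPT}$ be any subgame optimal algorithm, i.e. a randomized algorithm $A$ such that for every $0\le n\le T$ and every observed history $h=(x_1,\dots,x_n)$, $A$ minimizes $$\max_{\mathbf X\text{ extending }h}\frac{A'(\mathbf X)}{\mathrm{OPT}(\mathbf X)}$$ among all randomized algorithms $A'$ that have taken the same (randomized) decisions as $A$ along $h$ before $x_n$ was observed (that is, for each $m<n$ the probability of having continued on the first $m$ days of $h$ is the same for $A'$ and $A$). Then $$\max_{\mathbf X\in\{0,1\}^T}\frac{\text{WC-OPT}(\mathbf X)}{\text{SG-OPT}(\mathbf X)}=\beta ,$$ and - if $\lceil B\rceil+\lfloor B\rfloor\ge T+1$, then $\displaystyle \beta=\frac{1}{1-\frac{T-B}{\lfloor B\rfloor}\left(\frac{B-1}{B}\right)^{T-\lfloor B\rfloor}}$; - if $\lceil B\rceil+\lfloor B\rfloor< T+1$, then $\displaystyle \beta=\frac{1}{1-\frac{\lceil B\rceil-1}{B}\left(\frac{B-1}{B}\right)^{\lceil B\rceil-1}}$. -/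

import Mathlib

open scoped ENNReal

namespace SkiRental

/-- What the agent may do on a day, after having observed the weather of that day. -/
inductive Decision where
  | halt
  | cont
  deriving DecidableEq

instance : Fintype Decision where
  elems := {Decision.halt, Decision.cont}
  complete := by intro x; cases x <;> simp

/-- A sequence of `T` days; `true` is a day of good weather, `false` a day of bad weather. -/
abbrev Days (T : ℕ) := Fin T → Bool

/-- A deterministic online algorithm: for each day `i`, a map from the weather observed on the
days `0, …, i` to a decision. -/
abbrev DetAlg (T : ℕ) := (i : Fin T) → (Fin (i.val + 1) → Bool) → Decision

/-- The weather observed on the days `0, …, i` when the sequence of days is `X`. -/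
def history {T : ℕ} (X : Days T) (i : Fin T) : Fin (i.val + 1) → Bool :=
  fun j => X (Fin.castLE i.isLt j)

/-- The algorithm `A` decides to continue on each of the first `n` days of `X`. -/
def Continues {T : ℕ} (A : DetAlg T) (X : Days T) (n : ℕ) : Prop :=
  ∀ j : Fin T, j.val < n → A j (history X j) = Decision.cont

open Classical in
/-- The cost of `A` along `X`: as long as `A` has not stopped, a day costs `B` if `A` stops on it,
and otherwise `1` or `0` according to whether the weather is good or bad. After stopping there are
no further costs. -/
noncomputable def cost {T : ℕ} (B : ℝ) (A : DetAlg T) (X : Days T) : ℝ :=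
  ∑ i : Fin T,
    if Continues A X i.val then
      (if A i (history X i) = Decision.halt then B else if X i = true then 1 else 0)
    else 0

/-- The optimal hindsight cost: the least cost along `X` of any algorithm. -/
noncomputable def hindsightCost {T : ℕ} (B : ℝ) (X : Days T) : ℝ :=
  ⨅ A : DetAlg T, cost B A X

/-- Randomized algorithms: probability distributions over the finite set of deterministic
algorithms. -/
abbrev RandAlg (T : ℕ) := stdSimplex ℝ (DetAlg T)

/-- The expected cost of a randomized algorithm along `X`. -/
noncomputable def expCost {T : ℕ} (B : ℝ) (p : RandAlg T) (X : Days T) : ℝ :=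
  ∑ A : DetAlg T, p.1 A * cost B A X

/-- The quotient of two costs, with `c / 0 = ∞` for `c > 0` and `0 / 0 = 0`. -/
noncomputable def costRatio (c d : ℝ) : ℝ≥0∞ :=
  ENNReal.ofReal c / ENNReal.ofReal d

/-- The worst ratio of the expected cost of `p` to the optimal hindsight cost over a set of
sequences of days. -/
noncomputable def worstRatio {T : ℕ} (B : ℝ) (p : RandAlg T) (S : Set (Days T)) : ℝ≥0∞ :=
  ⨆ X ∈ S, costRatio (expCost B p X) (hindsightCost B X)

/-- The value of the game between the algorithm and the adversary: the least worst-case ratio of a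
randomized algorithm. -/
noncomputable def gameValue (T : ℕ) (B : ℝ) : ℝ≥0∞ :=
  ⨅ p : RandAlg T, worstRatio B p Set.univ

/-- `p` minimizes the worst-case ratio. -/
def IsWorstCaseOptimal {T : ℕ} (B : ℝ) (p : RandAlg T) : Prop :=
  ∀ q : RandAlg T, worstRatio B p Set.univ ≤ worstRatio B q Set.univ

/-- The algorithm that ignores days of bad weather, continues on the first `l` days of good weather
and stops on the next one. -/
def thresholdAlg {T : ℕ} (l : ℕ) : DetAlg T :=
  fun i x =>
    if x (Fin.last i.val) = true ∧ l < (Finset.univ.filter fun j => x j = true).card then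
      Decision.halt
    else Decision.cont

/-- WC-OPT: a worst-case optimal randomization over the algorithms that ignore days of bad weather,
namely over `thresholdAlg l` with `0 ≤ l ≤ T`. -/
def IsWCOpt {T : ℕ} (B : ℝ) (p : RandAlg T) : Prop :=
  (∀ A : DetAlg T, p.1 A ≠ 0 → ∃ l ≤ T, A = thresholdAlg l) ∧ IsWorstCaseOptimal B p

open Classical in
/-- The probability that `p` continues on each of the first `n` days of `X`. -/
noncomputable def contProb {T : ℕ} (p : RandAlg T) (X : Days T) (n : ℕ) : ℝ :=
  ∑ A : DetAlg T, if Continues A X n then p.1 A else 0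

/-- The sequences that start with the first `n` days of `X`. -/
def extensions {T : ℕ} (X : Days T) (n : ℕ) : Set (Days T) :=
  {Y | ∀ j : Fin T, j.val < n → Y j = X j}

/-- `q` and `p` took the same (random) decisions before the `n`-th day of `X` was observed, i.e. on
each of the first `n - 1` days. -/
def SamePast {T : ℕ} (q p : RandAlg T) (X : Days T) (n : ℕ) : Prop :=
  ∀ m < n, contProb q X m = contProb p X m

/-- SG-OPT: at every node of the game tree, that is after each observed history (the first `n` days
of some `X`), the decisions still to be taken minimize the worst ratio over all continuations of
that history, given the decisions taken so far. The adversary is non-adaptive: it does not see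
whether the algorithm has already stopped. -/
def IsSubgameOptimal {T : ℕ} (B : ℝ) (p : RandAlg T) : Prop :=
  ∀ (X : Days T) (n : ℕ), n ≤ T → ∀ q : RandAlg T, SamePast q p X n →
    worstRatio B p (extensions X n) ≤ worstRatio B q (extensions X n)

end SkiRental

namespace SkiRental

open Finset

/-! ### Observed histories and survival -/

/-! Let `b` be the value. The gap between the two algorithms appears on the sequence whose only good
day is the last. A finite worst ratio forbids stopping on the all-bad sequence, so a subgame optimal
algorithm has not stopped before that last day; it then minimizes the cost of that one day and pays
`min 1 B`. A threshold mixture sees only the number of good days, so WC-OPT pays there what it pays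
when only the first day is good. Everything rests on showing that this is `b * min 1 B`. No larger
ratio occurs, because WC-OPT costs at most `b` times the hindsight optimum, which SG-OPT cannot
beat.

For `B > 1`, let `Q i` be the probability of surviving `i` good days. Competitiveness on `k ≤ d`
initial good days bounds `Q k` from below by the sequence `c = survival B b` that makes all these
constraints equalities. Survivors of `d` good days, where `d < B`, still have to pay: with `μ = min
B (T - d)`, the cost on `T` good days is at least `b * d + μ * c d`. Choosing `b` so that this
equals `b * B` gives the lower bound (`goodCost_lower_bound`); strictness in the same estimate
forces ratio `b` already on the first good day. The mixture with survival probabilities `c` attains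
`b` (`exists_competitive`). The two closed forms correspond to survivors continuing to the end (`μ =
T - d`, `d = T - ⌊B⌋₊`) or stopping on the next good day (`μ = B`, `d = ⌈B⌉₊ - 1`). -/

theorem history_congr {T : ℕ} {X Y : Days T} {i : Fin T} (h : ∀ j ≤ i, X j = Y j) :
    history X i = history Y i := by
  funext j
  exact h _ (Fin.le_def.mpr (Nat.lt_succ_iff.mp j.isLt))

theorem continues_congr {T : ℕ} (A : DetAlg T) {X Y : Days T} {n : ℕ}
    (h : ∀ j : Fin T, j.val < n → X j = Y j) : Continues A X n ↔ Continues A Y n := by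
  refine forall_congr' fun j => forall_congr' fun hj => ?_
  rw [history_congr fun k hk => h k (lt_of_le_of_lt hk hj)]

theorem continues_zero {T : ℕ} (A : DetAlg T) (X : Days T) : Continues A X 0 :=
  fun _ h => absurd h (Nat.not_lt_zero _)

theorem continues_succ {T : ℕ} (A : DetAlg T) (X : Days T) (i : Fin T) :
    Continues A X (i.val + 1) ↔ Continues A X i.val ∧ A i (history X i) = Decision.cont := by
  constructor
  · exact fun h => ⟨fun j hj => h j (by omega), h i (by omega)⟩
  · rintro ⟨h, hi⟩ j hj
    rcases Nat.lt_succ_iff_lt_or_eq.mp hj with hj | hj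
    · exact h j hj
    · obtain rfl : j = i := Fin.ext hj
      exact hi

theorem Continues.mono {T : ℕ} {A : DetAlg T} {X : Days T} {m n : ℕ} (h : Continues A X n)
    (hmn : m ≤ n) : Continues A X m :=
  fun j hj => h j (by omega)

theorem contProb_congr {T : ℕ} (p : RandAlg T) {X Y : Days T} {n : ℕ}
    (h : ∀ j : Fin T, j.val < n → X j = Y j) : contProb p X n = contProb p Y n := by
  unfold contProb
  refine sum_congr rfl fun A _ => ?_
  have hc := continues_congr A h
  by_cases hX : Continues A X n
  · rw [if_pos hX, if_pos (hc.mp hX)]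
  · rw [if_neg hX, if_neg fun hY => hX (hc.mpr hY)]

theorem contProb_zero {T : ℕ} (p : RandAlg T) (X : Days T) : contProb p X 0 = 1 := by
  simp only [contProb, continues_zero, if_true]
  exact p.2.2

theorem contProb_nonneg {T : ℕ} (p : RandAlg T) (X : Days T) (n : ℕ) : 0 ≤ contProb p X n :=
  sum_nonneg fun A _ => by split_ifs; exacts [p.2.1 A, le_rfl]

theorem contProb_antitone {T : ℕ} (p : RandAlg T) (X : Days T) : Antitone (contProb p X) := by
  intro m n hmn
  refine sum_le_sum fun A _ => ?_
  by_cases h : Continues A X n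
  · simp [h, h.mono hmn]
  · rw [if_neg h]
    split_ifs
    exacts [p.2.1 A, le_rfl]

/-! ### Costs -/

/-- The number of good days among the first `n` days. -/
def goods {T : ℕ} (X : Days T) (n : ℕ) : ℕ :=
  (univ.filter fun i : Fin T => i.val < n ∧ X i = true).card

theorem goods_zero {T : ℕ} (X : Days T) : goods X 0 = 0 := by
  simp [goods]

theorem goods_succ {T : ℕ} (X : Days T) (i : Fin T) :
    goods X (i.val + 1) = goods X i.val + if X i = true then 1 else 0 := by
  unfold goods
  simp only [card_filter]
  have hi : (if X i = true then 1 else 0) =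
      ∑ j, if j = i then (if X j = true then 1 else 0) else 0 := by simp
  rw [hi, ← sum_add_distrib]
  refine sum_congr rfl fun j _ => ?_
  have : j = i ↔ j.val = i.val := Fin.ext_iff
  by_cases h1 : j.val < i.val <;> by_cases h2 : j.val = i.val <;> by_cases h3 : X j = true <;>
    simp [this, h1, h2, h3] <;> omega

theorem goods_le {T : ℕ} (X : Days T) (n : ℕ) : goods X n ≤ T :=
  (card_le_univ _).trans_eq (Fintype.card_fin T)

theorem sum_fin_sub {T : ℕ} (u : ℕ → ℝ) :
    ∑ i : Fin T, (u (i.val + 1) - u i.val) = u T - u 0 := by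
  rw [Fin.sum_univ_eq_sum_range (fun n => u (n + 1) - u n) T, Finset.sum_range_sub]

theorem sum_good {T : ℕ} (X : Days T) :
    ∑ i : Fin T, (if X i = true then (1 : ℝ) else 0) = goods X T := by
  have h := sum_fin_sub (T := T) fun n => (goods X n : ℝ)
  rw [goods_zero, Nat.cast_zero, sub_zero] at h
  rw [← h]
  refine sum_congr rfl fun i _ => ?_
  rw [goods_succ]
  split_ifs <;> simp

theorem card_history {T : ℕ} (X : Days T) (i : Fin T) :
    (univ.filter fun j => history X i j = true).card = goods X (i.val + 1) := by
  unfold goods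
  refine card_bij (fun j _ => Fin.castLE i.isLt j) ?_ ?_ ?_
  · intro j hj
    simp only [mem_filter, mem_univ, true_and] at hj ⊢
    exact ⟨j.isLt, hj⟩
  · intro j _ k _ h
    exact Fin.castLE_injective _ h
  · intro k hk
    simp only [mem_filter, mem_univ, true_and] at hk
    exact ⟨⟨k.val, hk.1⟩, mem_filter.mpr ⟨mem_univ _, hk.2⟩, rfl⟩

theorem thresholdAlg_history {T : ℕ} (l : ℕ) (X : Days T) (i : Fin T) :
    thresholdAlg l i (history X i) =
      if X i = true ∧ l < goods X (i.val + 1) then Decision.halt else Decision.cont := by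
  unfold thresholdAlg
  rw [card_history]
  rfl

theorem continues_thresholdAlg {T : ℕ} (l : ℕ) (X : Days T) {n : ℕ} (hn : n ≤ T) :
    Continues (thresholdAlg l) X n ↔ goods X n ≤ l := by
  induction n with
  | zero => simp [continues_zero, goods_zero]
  | succ n ih =>
    have hs := continues_succ (thresholdAlg l) X ⟨n, hn⟩
    have hg := goods_succ X ⟨n, hn⟩
    simp only at hs hg
    rw [hs, ih (by omega), thresholdAlg_history]
    by_cases hX : X ⟨n, hn⟩ = true
    · simp only [hX, true_and, if_true] at hg ⊢
      split_ifs with h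
      · simp; omega
      · simp; omega
    · simp [hX] at hg ⊢
      simp [hg]

/-- The cost of the threshold algorithm `l` when there are `k` good days. -/
noncomputable def thresholdCost (B : ℝ) (l k : ℕ) : ℝ :=
  if k ≤ l then (k : ℝ) else l + B

/-- `thresholdCost` evaluated at the running count of good days is the cost so far, so the daily
costs are its increments and telescope. -/
theorem cost_thresholdAlg {T : ℕ} (B : ℝ) (l : ℕ) (X : Days T) :
    cost B (thresholdAlg l) X = thresholdCost B l (goods X T) := by
  have h := sum_fin_sub (T := T) fun n => thresholdCost B l (goods X n)
  have h0 : thresholdCost B l (goods X 0) = 0 := by simp [goods_zero, thresholdCost]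
  simp only [h0, sub_zero] at h
  rw [← h]
  unfold cost
  refine sum_congr rfl fun i _ => ?_
  simp only [continues_thresholdAlg l X i.isLt.le, thresholdAlg_history, goods_succ, thresholdCost]
  by_cases hX : X i = true
  · simp only [hX, true_and, if_true]
    rcases lt_trichotomy (goods X i.val) l with h1 | h1 | h1
    · rw [if_pos h1.le, if_neg (by simp; omega), if_pos (by omega), if_pos h1.le]
      push_cast; ring
    · rw [if_pos h1.le, if_pos (by simp; omega), if_neg (by omega), if_pos h1.le, h1]
      ring
    · rw [if_neg (by omega), if_neg (by omega), if_neg (by omega)]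
      ring
  · simp [hX]

theorem cost_term_nonneg {T : ℕ} {B : ℝ} (hB : 0 ≤ B) (A : DetAlg T) (X : Days T) (i : Fin T) :
    0 ≤ (open Classical in if Continues A X i.val then
      (if A i (history X i) = Decision.halt then B else if X i = true then 1 else 0) else 0) := by
  split_ifs <;> first | exact hB | norm_num

theorem cost_nonneg {T : ℕ} {B : ℝ} (hB : 0 ≤ B) (A : DetAlg T) (X : Days T) : 0 ≤ cost B A X :=
  sum_nonneg fun i _ => cost_term_nonneg hB A X i

theorem le_cost_of_not_continues {T : ℕ} {B : ℝ} (hB : 0 ≤ B) {A : DetAlg T} {X : Days T}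
    (h : ¬ Continues A X T) : B ≤ cost B A X := by
  classical
  have hex : ∃ n, n < T ∧ Continues A X n ∧ ¬ Continues A X (n + 1) := by
    by_contra! hc
    have : ∀ n, n ≤ T → Continues A X n := by
      intro n
      induction n with
      | zero => exact fun _ => continues_zero A X
      | succ n ih => exact fun hn => hc n hn (ih (by omega))
    exact h (this T le_rfl)
  obtain ⟨n, hn, hc, hc'⟩ := hex
  have hs := continues_succ A X ⟨n, hn⟩
  have hh : A ⟨n, hn⟩ (history X ⟨n, hn⟩) = Decision.halt := by
    rcases hA : A ⟨n, hn⟩ (history X ⟨n, hn⟩) with _ | _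
    · rfl
    · exact absurd (hs.mpr ⟨hc, hA⟩) hc'
  have := single_le_sum (f := fun i : Fin T => if Continues A X i.val then
      (if A i (history X i) = Decision.halt then B else if X i = true then 1 else 0) else 0)
    (fun i _ => by convert cost_term_nonneg hB A X i) (mem_univ ⟨n, hn⟩)
  simp only [hc, hh, if_true] at this
  unfold cost
  convert this

theorem cost_of_continues {T : ℕ} (B : ℝ) {A : DetAlg T} {X : Days T} (h : Continues A X T) :
    cost B A X = goods X T := by
  rw [← sum_good]
  unfold cost
  refine sum_congr rfl fun i _ => ?_
  rw [if_pos (h.mono i.isLt.le), h i i.isLt]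
  simp

theorem min_le_cost {T : ℕ} {B : ℝ} (hB : 0 ≤ B) (A : DetAlg T) (X : Days T) :
    min (goods X T : ℝ) B ≤ cost B A X := by
  by_cases h : Continues A X T
  · rw [cost_of_continues B h]; exact min_le_left _ _
  · exact (min_le_right _ _).trans (le_cost_of_not_continues hB h)

theorem hindsightCost_eq {T : ℕ} {B : ℝ} (hB : 0 ≤ B) (X : Days T) :
    hindsightCost B X = min (goods X T : ℝ) B := by
  have hbdd : BddBelow (Set.range fun A : DetAlg T => cost B A X) :=
    ⟨0, by rintro _ ⟨A, rfl⟩; exact cost_nonneg hB A X⟩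
  have : Nonempty (DetAlg T) := ⟨thresholdAlg 0⟩
  refine le_antisymm (le_min ?_ ?_) (le_ciInf fun A => min_le_cost hB A X)
  · refine (ciInf_le hbdd (thresholdAlg T)).trans (le_of_eq ?_)
    rw [cost_thresholdAlg, thresholdCost, if_pos (goods_le X T)]
  · refine (ciInf_le hbdd (thresholdAlg 0)).trans ?_
    rw [cost_thresholdAlg, thresholdCost]
    split_ifs with h
    · simpa [Nat.le_zero.mp h] using hB
    · simp

theorem expCost_nonneg {T : ℕ} {B : ℝ} (hB : 0 ≤ B) (p : RandAlg T) (X : Days T) :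
    0 ≤ expCost B p X :=
  sum_nonneg fun A _ => mul_nonneg (p.2.1 A) (cost_nonneg hB A X)

theorem hindsightCost_le_expCost {T : ℕ} {B : ℝ} (hB : 0 ≤ B) (p : RandAlg T) (X : Days T) :
    hindsightCost B X ≤ expCost B p X := by
  rw [hindsightCost_eq hB]
  calc min (goods X T : ℝ) B = ∑ A : DetAlg T, p.1 A * min (goods X T : ℝ) B := by
        rw [← sum_mul, p.2.2, one_mul]
    _ ≤ expCost B p X :=
        sum_le_sum fun A _ => mul_le_mul_of_nonneg_left (min_le_cost hB A X) (p.2.1 A)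

/-! ### Ratios -/

/-- The product form stays exact at `d = 0`: there the right side forces `c = 0`, in agreement with
`0 / 0 = 0` and `c / 0 = ∞`. -/
theorem costRatio_le_iff {c d b : ℝ} (hc : 0 ≤ c) (hd : 0 ≤ d) (hb : 0 ≤ b) :
    costRatio c d ≤ ENNReal.ofReal b ↔ c ≤ b * d := by
  unfold costRatio
  rcases hd.eq_or_lt with rfl | hd
  · rcases hc.eq_or_lt with rfl | hc
    · simp
    · simp [ENNReal.div_zero (ENNReal.ofReal_pos.mpr hc).ne', hc.not_ge]
  · rw [← ENNReal.ofReal_div_of_pos hd, ENNReal.ofReal_le_ofReal_iff hb, div_le_iff₀ hd]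

theorem costRatio_mul_self {b d : ℝ} (hd : 0 < d) :
    costRatio (b * d) d = ENNReal.ofReal b := by
  unfold costRatio
  rw [← ENNReal.ofReal_div_of_pos hd, mul_div_cancel_right₀ _ hd.ne']

theorem hindsightCost_nonneg {T : ℕ} {B : ℝ} (hB : 0 ≤ B) (X : Days T) :
    0 ≤ hindsightCost B X := by
  rw [hindsightCost_eq hB]; positivity

theorem worstRatio_le_iff {T : ℕ} {B b : ℝ} (hB : 0 ≤ B) (hb : 0 ≤ b) (p : RandAlg T)
    (S : Set (Days T)) :
    worstRatio B p S ≤ ENNReal.ofReal b ↔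
      ∀ X ∈ S, expCost B p X ≤ b * hindsightCost B X := by
  unfold worstRatio
  simp only [iSup_le_iff,
    costRatio_le_iff (expCost_nonneg hB _ _) (hindsightCost_nonneg hB _) hb]

/-! ### Special sequences and algorithms -/

/-- The sequence of `k` good days followed by bad days. -/
def goodThenBad (T k : ℕ) : Days T := fun i => decide (i.val < k)

/-- The sequence in which only the last day is good. -/
def lastGood (T : ℕ) : Days T := fun i => decide (i.val + 1 = T)

theorem goods_goodThenBad {T k : ℕ} (hk : k ≤ T) : goods (goodThenBad T k) T = k := by
  unfold goods goodThenBad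
  simp only [Fin.is_lt, decide_eq_true_eq, true_and]
  rw [Fin.card_filter_val_lt]
  exact min_eq_right hk

theorem goods_lastGood_of_lt {T n : ℕ} (hn : n < T) : goods (lastGood T) n = 0 := by
  unfold goods lastGood
  rw [card_eq_zero, filter_eq_empty_iff]
  intro i _
  simp only [decide_eq_true_eq]
  omega

theorem goods_lastGood {T : ℕ} (hT : 0 < T) : goods (lastGood T) T = 1 := by
  obtain ⟨n, rfl⟩ : ∃ n, T = n + 1 := ⟨T - 1, by omega⟩
  have h := goods_succ (lastGood (n + 1)) ⟨n, Nat.lt_succ_self n⟩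
  simp only [goods_lastGood_of_lt (Nat.lt_succ_self n)] at h
  simpa [lastGood] using h

/-- A deterministic algorithm as a randomized algorithm. -/
noncomputable def pureAlg {T : ℕ} (A : DetAlg T) : RandAlg T :=
  ⟨Pi.single A 1, single_mem_stdSimplex ℝ A⟩

theorem expCost_pureAlg {T : ℕ} (B : ℝ) (A : DetAlg T) (X : Days T) :
    expCost B (pureAlg A) X = cost B A X := by
  simp [expCost, pureAlg, Pi.single_apply]

theorem contProb_pureAlg_of_continues {T : ℕ} {A : DetAlg T} {X : Days T} {n : ℕ}
    (h : Continues A X n) : contProb (pureAlg A) X n = 1 := by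
  classical
  unfold contProb pureAlg
  rw [sum_eq_single A]
  · simp [h]
  · intro b _ hb
    simp [hb]
  · simp

/-- A threshold algorithm that is optimal when there is a single good day. -/
noncomputable def singleGoodThreshold (T : ℕ) (B : ℝ) : ℕ := if 1 ≤ B then T else 0

theorem thresholdCost_singleGoodThreshold {T : ℕ} (hT : 0 < T) (B : ℝ) :
    thresholdCost B (singleGoodThreshold T B) 1 = min 1 B := by
  unfold thresholdCost singleGoodThreshold
  by_cases h : 1 ≤ B
  · rw [if_pos h, if_pos (by omega), min_eq_left h]; simp
  · rw [if_neg h, if_neg (by omega), min_eq_right (by linarith)]; simp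

/-! ### Subgame optimal algorithms -/

/-- Any algorithm that stops pays at least `B > 0`, so it has weight zero when the expected cost
vanishes. -/
theorem contProb_eq_one_of_bad {T : ℕ} {B : ℝ} (hB : 0 < B) {p : RandAlg T}
    (h : expCost B p (fun _ => false) ≤ 0) {n : ℕ} (hn : n ≤ T) :
    contProb p (fun _ => false) n = 1 := by
  have h0 : ∀ A ∈ (univ : Finset (DetAlg T)), p.1 A * cost B A (fun _ => false) = 0 :=
    (sum_eq_zero_iff_of_nonneg fun A _ =>
      mul_nonneg (p.2.1 A) (cost_nonneg hB.le A _)).mp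
      (le_antisymm h (expCost_nonneg hB.le p _))
  rw [← p.2.2]
  unfold contProb
  refine sum_congr rfl fun A hA => ?_
  by_cases hc : Continues A (fun _ => false) n
  · rw [if_pos hc]
  · rw [if_neg hc]
    have h1 := le_cost_of_not_continues hB.le fun h' => hc (h'.mono hn)
    exact ((mul_eq_zero.mp (h0 A hA)).resolve_right (by linarith)).symm

theorem IsSubgameOptimal.isWorstCaseOptimal {T : ℕ} {B : ℝ} {p : RandAlg T}
    (h : IsSubgameOptimal B p) : IsWorstCaseOptimal B p := by
  intro q
  have h0 := h (fun _ => false) 0 (Nat.zero_le _) q fun m hm => absurd hm (Nat.not_lt_zero m)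
  have he : extensions (fun _ : Fin T => false) 0 = Set.univ :=
    Set.eq_univ_of_forall fun Y j hj => absurd hj (Nat.not_lt_zero _)
  rwa [he] at h0

theorem IsSubgameOptimal.expCost_lastGood {T : ℕ} (hT : 0 < T) {B b : ℝ} (hB : 0 < B)
    (hb : 0 ≤ b) {p : RandAlg T} (h : IsSubgameOptimal B p)
    (hp : worstRatio B p Set.univ ≤ ENNReal.ofReal b) :
    expCost B p (lastGood T) = min 1 B := by
  have hopt : hindsightCost B (lastGood T) = min 1 B := by
    rw [hindsightCost_eq hB.le, goods_lastGood hT, Nat.cast_one]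
  have hbad : expCost B p (fun _ => false) ≤ 0 := by
    have h1 := (worstRatio_le_iff hB.le hb p _).mp hp (fun _ => false) (Set.mem_univ _)
    have h2 : goods (fun _ : Fin T => false) T = 0 := by simp [goods]
    rw [hindsightCost_eq hB.le, h2] at h1
    simpa [hB.le] using h1
  -- Only bad days precede the last one, so both algorithms survive them with probability one. Hence
  -- the threshold algorithm is an admissible competitor at the final node.
  have hsame : SamePast (pureAlg (thresholdAlg (singleGoodThreshold T B))) p (lastGood T) T := by
    intro m hm
    rw [contProb_pureAlg_of_continues
      ((continues_thresholdAlg _ _ hm.le).mpr (goods_lastGood_of_lt hm ▸ Nat.zero_le _)),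
      ← contProb_eq_one_of_bad hB hbad hm.le]
    refine contProb_congr p fun j hj => ?_
    simp only [lastGood, false_eq_decide_iff]
    omega
  -- The full history has a single extension, so optimality here compares costs on one sequence.
  have h1 := h (lastGood T) T le_rfl _ hsame
  have h2 : worstRatio B (pureAlg (thresholdAlg (singleGoodThreshold T B)))
      (extensions (lastGood T) T) ≤ ENNReal.ofReal 1 := by
    rw [worstRatio_le_iff hB.le zero_le_one]
    intro X hX
    obtain rfl : X = lastGood T := funext fun j => hX j j.isLt
    rw [expCost_pureAlg, cost_thresholdAlg, goods_lastGood hT,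
      thresholdCost_singleGoodThreshold hT, hopt, one_mul]
  have h3 := (worstRatio_le_iff hB.le zero_le_one p _).mp (h1.trans h2) (lastGood T)
    fun _ _ => rfl
  rw [one_mul, hopt] at h3
  exact le_antisymm h3 (hopt ▸ hindsightCost_le_expCost hB.le p _)

/-- If every `b`-competitive algorithm has ratio `b` when the first day is the only good one, then
the comparison of a worst-case optimal threshold mixture with a subgame optimal algorithm has worst
ratio `b`. -/
theorem isGreatest_costRatio {T : ℕ} (hT : 0 < T) {B b : ℝ} (hB : 0 < B) (hb : 0 ≤ b)
    (hval : gameValue T B = ENNReal.ofReal b)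
    (htight : ∀ p : RandAlg T, (∀ X, expCost B p X ≤ b * hindsightCost B X) →
      b * min 1 B ≤ expCost B p (goodThenBad T 1))
    {WC SG : RandAlg T} (hWC : IsWCOpt B WC) (hSG : IsSubgameOptimal B SG) :
    IsGreatest (Set.range fun X : Days T => costRatio (expCost B WC X) (expCost B SG X))
      (gameValue T B) := by
  have hWCle : worstRatio B WC Set.univ ≤ ENNReal.ofReal b := hval ▸ le_iInf hWC.2
  have hSGle : worstRatio B SG Set.univ ≤ ENNReal.ofReal b :=
    hval ▸ le_iInf hSG.isWorstCaseOptimal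
  have hWCle' := (worstRatio_le_iff hB.le hb WC _).mp hWCle
  rw [hval]
  constructor
  -- Moving the single good day from first to last leaves the cost of WC-OPT unchanged, while SG-OPT
  -- becomes optimal in hindsight.
  · refine ⟨lastGood T, ?_⟩
    have heq : expCost B WC (lastGood T) = expCost B WC (goodThenBad T 1) := by
      unfold expCost
      refine sum_congr rfl fun A _ => ?_
      by_cases hA : WC.1 A = 0
      · rw [hA, zero_mul, zero_mul]
      · obtain ⟨l, -, rfl⟩ := hWC.1 A hA
        rw [cost_thresholdAlg, cost_thresholdAlg, goods_lastGood hT, goods_goodThenBad hT]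
    have h1 := htight WC fun X => hWCle' X (Set.mem_univ X)
    have h2 := hWCle' (lastGood T) (Set.mem_univ _)
    rw [hindsightCost_eq hB.le, goods_lastGood hT, Nat.cast_one] at h2
    simp only [hSG.expCost_lastGood hT hB hb hSGle]
    rw [le_antisymm h2 (heq ▸ h1), costRatio_mul_self (lt_min one_pos hB)]
  · rintro _ ⟨X, rfl⟩
    simp only
    rw [costRatio_le_iff (expCost_nonneg hB.le _ _) (expCost_nonneg hB.le _ _) hb]
    exact (hWCle' X (Set.mem_univ X)).trans
      (mul_le_mul_of_nonneg_left (hindsightCost_le_expCost hB.le SG X) hb)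

/-! ### The lower bound on the value -/

/-- On a good day a survivor pays `B` if it stops and `1 = B - (B - 1)` if it continues. Only an
inequality holds, since stopping on a later bad day also costs. -/
theorem sum_le_cost_goodThenBad {T k : ℕ} (hk : k ≤ T) {B : ℝ} (hB : 0 ≤ B) (A : DetAlg T) :
    (open Classical in ∑ i ∈ range k, (B * (if Continues A (fun _ => true) i then 1 else 0) -
      (B - 1) * (if Continues A (fun _ => true) (i + 1) then 1 else 0))) ≤
      cost B A (goodThenBad T k) := by
  classical
  set φ : ℕ → ℝ := fun i => B * (if Continues A (fun _ => true) i then 1 else 0) -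
      (B - 1) * (if Continues A (fun _ => true) (i + 1) then 1 else 0) with hφ
  have h1 : ∑ i ∈ range k, φ i = ∑ i : Fin T, if i.val < k then φ i.val else 0 := by
    rw [Fin.sum_univ_eq_sum_range (fun n => if n < k then φ n else 0) T, ← sum_filter]
    congr 1
    ext n
    simp only [mem_range, mem_filter]
    omega
  have h2 : ∑ i ∈ range k, φ i ≤ cost B A (goodThenBad T k) := by
    rw [h1]
    unfold cost
    refine sum_le_sum fun i _ => ?_
    by_cases hi : i.val < k
    · have hag : ∀ j : Fin T, j.val ≤ i.val → goodThenBad T k j = true := fun j hj => by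
        simp only [goodThenBad, decide_eq_true_eq]; omega
      have hc := continues_congr A (X := goodThenBad T k) (Y := fun _ => true) (n := i.val)
        fun j hj => hag j hj.le
      have hh : history (goodThenBad T k) i = history (fun _ => true) i :=
        history_congr fun j hj => hag j hj
      have hs := continues_succ A (fun _ => true) i
      simp only [hi, hφ, hc, hh, hs, hag i le_rfl, if_true]
      by_cases h3 : Continues A (fun _ => true) i.val
      · rcases hA : A i (history (fun _ => true) i) with _ | _
        · simp [h3]
        · simp [h3]
      · simp [h3]
    · rw [if_neg hi]
      exact cost_term_nonneg hB A _ i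
  exact h2

/-- The costs that an algorithm with survival probabilities `Q` accumulates on `k` good days. -/
def goodCost (B : ℝ) (Q : ℕ → ℝ) (k : ℕ) : ℝ :=
  ∑ i ∈ range k, (B * Q i - (B - 1) * Q (i + 1))

theorem goodCost_le_expCost {T k : ℕ} (hk : k ≤ T) {B : ℝ} (hB : 0 ≤ B) (p : RandAlg T) :
    goodCost B (contProb p fun _ => true) k ≤ expCost B p (goodThenBad T k) := by
  classical
  refine le_trans (le_of_eq ?_)
    (sum_le_sum fun A _ => mul_le_mul_of_nonneg_left (sum_le_cost_goodThenBad hk hB A) (p.2.1 A))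
  simp only [goodCost, contProb, mul_sum]
  rw [sum_comm' (t' := range k) (s' := fun _ => univ) (by simp)]
  refine sum_congr rfl fun i _ => ?_
  rw [← sum_sub_distrib]
  refine sum_congr rfl fun A _ => ?_
  change _ = p.1 A * _
  split_ifs <;> ring

/-- The summand is `Q i` plus `B - 1` times a decrement of `Q`. In this form an upper bound on the
cost becomes, for `B > 1`, a lower bound on `Q k` in terms of earlier values. -/
theorem goodCost_eq (B : ℝ) (Q : ℕ → ℝ) (k : ℕ) :
    goodCost B Q k = ∑ i ∈ range k, Q i + (B - 1) * (Q 0 - Q k) := by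
  unfold goodCost
  rw [← sum_range_sub', mul_sum, ← sum_add_distrib]
  exact sum_congr rfl fun i _ => by ring

/-- The survival probabilities that make the ratio equal to `b` on every small number of good
days. -/
noncomputable def survival (B b : ℝ) (j : ℕ) : ℝ := b - (b - 1) * (B / (B - 1)) ^ j

theorem survival_zero (B b : ℝ) : survival B b 0 = 1 := by simp [survival]

theorem survival_succ {B : ℝ} (hB : 1 < B) (b : ℝ) (j : ℕ) :
    B * survival B b j - (B - 1) * survival B b (j + 1) = b := by
  have h : (B - 1) * (B / (B - 1)) = B := mul_div_cancel₀ _ (by linarith)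
  unfold survival
  rw [pow_succ]
  linear_combination (b - 1) * (B / (B - 1)) ^ j * h

theorem survival_antitone {B b : ℝ} (hB : 1 < B) (hb : 1 ≤ b) : Antitone (survival B b) := by
  intro m n hmn
  have h : 1 ≤ B / (B - 1) := by rw [le_div_iff₀ (by linarith)]; linarith
  unfold survival
  have := mul_le_mul_of_nonneg_left (pow_le_pow_right₀ h hmn) (sub_nonneg.mpr hb)
  linarith

theorem goodCost_survival {B : ℝ} (hB : 1 < B) (b : ℝ) (k : ℕ) :
    goodCost B (survival B b) k = b * k := by
  simp [goodCost, survival_succ hB, mul_comm]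

/-- Subtracting the equalities satisfied by `c` from the constraints on `Q` bounds the accumulated
excess of `Q` over `c` by `B - 1` times the current excess, so inductively no excess is negative.
The cost on `T` good days then exceeds `b * B` by at least a positive combination of these excesses.
-/
theorem goodCost_lower_bound {T d : ℕ} {B b μ : ℝ} (hB : 1 < B) (hd : d < T)
    (hμB : μ ≤ B) (hμT : μ ≤ T - d) (hμ : B - 1 < μ)
    (heq : b * d + μ * survival B b d = b * B)
    {Q : ℕ → ℝ} (hQ0 : Q 0 = 1) (hQ : Antitone Q) (hQn : ∀ n, 0 ≤ Q n)
    (hle : ∀ k ≤ d, goodCost B Q k ≤ b * k) :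
    b * B ≤ goodCost B Q T ∧ (goodCost B Q T ≤ b * B → b ≤ goodCost B Q 1) := by
  set c := survival B b with hc
  have hc0 : c 0 = 1 := survival_zero B b
  have hrec : ∀ k ≤ d, ∑ i ∈ range k, (Q i - c i) ≤ (B - 1) * (Q k - c k) := by
    intro k hk
    have h1 := hle k hk
    rw [← goodCost_survival hB b k, goodCost_eq, goodCost_eq, hQ0, ← hc, hc0] at h1
    rw [sum_sub_distrib]
    linarith
  have hpos : ∀ k ≤ d, 0 ≤ Q k - c k := by
    intro k
    induction k using Nat.strong_induction_on with
    | _ k ih =>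
      intro hk
      have h1 : 0 ≤ ∑ i ∈ range k, (Q i - c i) :=
        sum_nonneg fun i hi => ih i (mem_range.mp hi) (by have := mem_range.mp hi; omega)
      exact nonneg_of_mul_nonneg_right (h1.trans (hrec k hk)) (by linarith)
  have hsum : ∑ i ∈ range d, Q i + Q d + (T - 1 - d) * Q T ≤ ∑ i ∈ range T, Q i := by
    rw [← sum_range_add_sum_Ico Q hd.le, sum_eq_sum_Ico_succ_bot hd]
    have h1 : ∑ i ∈ Ico (d + 1) T, Q T ≤ ∑ i ∈ Ico (d + 1) T, Q i :=
      sum_le_sum fun i hi => hQ (mem_Ico.mp hi).2.le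
    rw [sum_const, Nat.card_Ico, nsmul_eq_mul, Nat.cast_sub hd] at h1
    push_cast at h1
    linarith
  have hlow : b * B + ∑ i ∈ range d, (Q i - c i) + (μ - B + 1) * (Q d - c d) ≤
      goodCost B Q T := by
    have h1 := goodCost_survival hB b d
    rw [goodCost_eq, ← hc, hc0] at h1
    rw [goodCost_eq, hQ0, sum_sub_distrib]
    -- The sign of `μ - B` allows `Q T` to be replaced by the larger `Q d`; `μ ≤ T - d` and `0 ≤ Q
    -- T` do the rest.
    have h2 : (μ - B) * Q d ≤ (μ - B) * Q T :=
      mul_le_mul_of_nonpos_left (hQ hd.le) (by linarith)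
    have h3 : (μ - B) * Q T ≤ (T - d - B) * Q T :=
      mul_le_mul_of_nonneg_right (by linarith) (hQn T)
    linarith
  have hsum0 : 0 ≤ ∑ i ∈ range d, (Q i - c i) :=
    sum_nonneg fun i hi => hpos i (mem_range.mp hi).le
  have hd0 : 0 ≤ (μ - B + 1) * (Q d - c d) := mul_nonneg (by linarith) (hpos d le_rfl)
  refine ⟨by linarith, fun hup => ?_⟩
  have hQ1 : Q 1 ≤ 1 := hQ0 ▸ hQ zero_le_one
  have hF1 : goodCost B Q 1 = B - (B - 1) * Q 1 := by simp [goodCost, hQ0]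
  rw [hF1]
  -- For `d = 0` the equation reads `μ = b * B`, so `b ≤ 1`, and the first good day costs at least
  -- `1` anyway.
  rcases Nat.eq_zero_or_pos d with rfl | hdpos
  · rw [hc0] at heq
    have : b ≤ 1 := by
      by_contra! h
      have : B < b * B := by nlinarith
      simp at heq
      linarith
    nlinarith
  -- A first-day cost below `b` means `Q 1 > c 1`; `hrec` carries this excess to index `d`, where it
  -- pushes the total cost strictly above `b * B`.
  · by_contra! hlt
    have hD1 : 0 < Q 1 - c 1 := by
      have h1 := survival_succ hB b 0
      rw [zero_add, ← hc, hc0] at h1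
      have : 0 < (B - 1) * (Q 1 - c 1) := by linarith
      exact (mul_pos_iff_of_pos_left (by linarith)).mp this
    have hDd : 0 < Q d - c d := by
      rcases Nat.eq_or_lt_of_le hdpos with h | h
      · rwa [← h]
      · have h1 : Q 1 - c 1 ≤ ∑ i ∈ range d, (Q i - c i) :=
          single_le_sum (f := fun i => Q i - c i)
            (fun i hi => hpos i (mem_range.mp hi).le) (mem_range.mpr h)
        have := hrec d le_rfl
        have : 0 < (B - 1) * (Q d - c d) := by linarith
        exact (mul_pos_iff_of_pos_left (by linarith)).mp this
    have : 0 < (μ - B + 1) * (Q d - c d) := mul_pos (by linarith) hDd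
    linarith

/-! ### The upper bound on the value -/

/-- The mixture that stops on the good day `l + 1` with probability `c l - c (l + 1)` for `l < d`,
and follows the threshold algorithm `L` with the remaining probability `c d`. -/
noncomputable def thresholdMixture {T : ℕ} (c : ℕ → ℝ) (d L : ℕ) (h0 : c 0 = 1)
    (hc : Antitone c) (hd : 0 ≤ c d) : RandAlg T :=
  ⟨∑ l ∈ range d, (c l - c (l + 1)) • Pi.single (thresholdAlg l) (1 : ℝ) +
      c d • Pi.single (thresholdAlg L) (1 : ℝ), by
    have hs : ∀ A : DetAlg T, (0 : DetAlg T → ℝ) ≤ Pi.single A (1 : ℝ) := fun A =>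
      Pi.single_nonneg.mpr zero_le_one
    refine ⟨fun A => ?_, ?_⟩
    · have h : (0 : DetAlg T → ℝ) ≤ ∑ l ∈ range d,
          (c l - c (l + 1)) • Pi.single (thresholdAlg l) (1 : ℝ) +
          c d • Pi.single (thresholdAlg L) (1 : ℝ) :=
        add_nonneg (sum_nonneg fun l _ =>
          smul_nonneg (sub_nonneg.mpr (hc (Nat.le_succ l))) (hs _)) (smul_nonneg hd (hs _))
      exact h A
    · simp only [Pi.add_apply, Finset.sum_apply, Pi.smul_apply, smul_eq_mul]
      rw [sum_add_distrib, sum_comm]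
      simp only [← mul_sum, sum_pi_single', mem_univ, if_true, mul_one]
      rw [sum_range_sub', h0]
      ring⟩

theorem expCost_thresholdMixture {T : ℕ} (B : ℝ) (c : ℕ → ℝ) (d L : ℕ) (h0 : c 0 = 1)
    (hc : Antitone c) (hd : 0 ≤ c d) (X : Days T) :
    expCost B (thresholdMixture c d L h0 hc hd) X =
      ∑ l ∈ range d, (c l - c (l + 1)) * thresholdCost B l (goods X T) +
        c d * thresholdCost B L (goods X T) := by
  simp only [expCost, thresholdMixture, Pi.add_apply, Finset.sum_apply, Pi.smul_apply,
    smul_eq_mul, add_mul, sum_mul]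
  rw [sum_add_distrib, sum_comm]
  simp [Pi.single_apply, cost_thresholdAlg]

theorem sum_survival_mul_thresholdCost {B : ℝ} (hB : 1 < B) (b : ℝ) {k n : ℕ} (hkn : k ≤ n) :
    ∑ l ∈ range n, (survival B b l - survival B b (l + 1)) * thresholdCost B l k =
      b * k - k * survival B b n := by
  induction n, hkn using Nat.le_induction with
  | base =>
    have h : ∀ m : ℕ, ∑ l ∈ range m, (survival B b l - survival B b (l + 1)) * (l + B) =
        b * m - m * survival B b m := by
      intro m
      induction m with
      | zero => simp
      | succ m ih =>
        rw [sum_range_succ, ih]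
        push_cast
        linear_combination survival_succ hB b m
    rw [← h]
    refine sum_congr rfl fun l hl => ?_
    rw [thresholdCost, if_neg (by have := mem_range.mp hl; omega)]
  | succ n hn ih =>
    rw [sum_range_succ, ih, thresholdCost, if_pos hn]
    ring

theorem sum_survival_mul_thresholdCost_of_le {B : ℝ} (hB : 1 < B) (b : ℝ) {k n : ℕ}
    (hnk : n ≤ k) :
    ∑ l ∈ range n, (survival B b l - survival B b (l + 1)) * thresholdCost B l k =
      b * n - n * survival B b n := by
  rw [← sum_survival_mul_thresholdCost hB b le_rfl]
  refine sum_congr rfl fun l hl => ?_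
  have := mem_range.mp hl
  rw [thresholdCost, thresholdCost, if_neg (by omega), if_neg (by omega)]

/-- The mixture with survival probabilities `survival B b` pays exactly `b * k` on `k ≤ d` good
days. The remaining mass then acts so that the cost never exceeds `b * B`. -/
theorem exists_competitive {T d : ℕ} {B b μ : ℝ} (hB : 1 < B) (hb : 1 ≤ b) (hd : d < T)
    (hdB : (d : ℝ) ≤ B) (hμ : B - 1 < μ)
    (hcase : μ = T - d ∨ μ = B ∧ B ≤ d + 1)
    (heq : b * d + μ * survival B b d = b * B) :
    ∃ p : RandAlg T, ∀ X, expCost B p X ≤ b * hindsightCost B X := by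
  have hcd : 0 ≤ survival B b d := by
    have : 0 ≤ μ * survival B b d := by nlinarith
    exact nonneg_of_mul_nonneg_right this (by linarith)
  have hanti := survival_antitone hB hb
  have hcd1 : survival B b d ≤ b := by
    have := hanti (Nat.zero_le d)
    rw [survival_zero] at this
    linarith
  obtain ⟨L, hdL, hL⟩ : ∃ L, d ≤ L ∧ ∀ k ≤ T, d < k →
      b * d - d * survival B b d + survival B b d * thresholdCost B L k ≤ b * min (k : ℝ) B := by
    rcases hcase with h | ⟨h, h'⟩
    -- Survivors never stop: each further good day adds `survival B b d ≤ b`, and the total reaches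
    -- `b * B` at `k = T`.
    · refine ⟨T, hd.le, fun k hk hdk => ?_⟩
      rw [thresholdCost, if_pos hk, mul_min_of_nonneg _ _ (by linarith : 0 ≤ b)]
      have hdk' : (0 : ℝ) ≤ k - d := sub_nonneg.mpr (by exact_mod_cast hdk.le)
      have hkT : (k : ℝ) ≤ T := by exact_mod_cast hk
      refine le_min ?_ ?_
      · have := mul_le_mul_of_nonneg_right hcd1 hdk'
        linarith
      · rw [← heq, h]
        have := mul_le_mul_of_nonneg_left hkT hcd
        linarith
    -- Survivors stop on good day `d + 1`. As `B ≤ d + 1`, the hindsight cost is already `B`, and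
    -- the cost is exactly `b * B`.
    · refine ⟨d, le_rfl, fun k hk hdk => ?_⟩
      have hdk' : (d : ℝ) + 1 ≤ k := by exact_mod_cast hdk
      rw [thresholdCost, if_neg (by omega), min_eq_right (by linarith), ← heq, h]
      linarith
  refine ⟨thresholdMixture (survival B b) d L (survival_zero B b) hanti hcd, fun X => ?_⟩
  rw [expCost_thresholdMixture, hindsightCost_eq (by linarith)]
  rcases le_or_gt (goods X T) d with h | h
  · have h' : (goods X T : ℝ) ≤ d := by exact_mod_cast h
    rw [sum_survival_mul_thresholdCost hB b h, thresholdCost, if_pos (h.trans hdL),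
      min_eq_left (by linarith)]
    linarith
  · rw [sum_survival_mul_thresholdCost_of_le hB b h.le]
    exact hL _ (goods_le X T) h

/-! ### The value -/

/-- The nonnegative number `b` is the value of the game, and every algorithm
attaining it has ratio at least `b` when the first day is the only good one. -/
def IsTightValue (T : ℕ) (B b : ℝ) : Prop :=
  0 ≤ b ∧ gameValue T B = ENNReal.ofReal b ∧
    ∀ p : RandAlg T, (∀ X, expCost B p X ≤ b * hindsightCost B X) →
      b * min 1 B ≤ expCost B p (goodThenBad T 1)

theorem gameValue_eq {T : ℕ} {B b : ℝ} (hB : 0 < B) (hb : 0 ≤ b)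
    (hup : ∃ p : RandAlg T, ∀ X, expCost B p X ≤ b * hindsightCost B X)
    (hlow : ∀ p : RandAlg T, (∀ X, expCost B p X ≤ b * hindsightCost B X) →
      ∃ X : Days T, 0 < hindsightCost B X ∧ b * hindsightCost B X ≤ expCost B p X) :
    gameValue T B = ENNReal.ofReal b := by
  refine le_antisymm ?_ (le_iInf fun p => ?_)
  · obtain ⟨p, hp⟩ := hup
    exact (iInf_le _ p).trans ((worstRatio_le_iff hB.le hb p _).mpr fun X _ => hp X)
  -- An algorithm with ratio below `b` is in particular `b`-competitive, so `hlow` applies to it.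
  · by_contra! hlt
    obtain ⟨X, hX, hle⟩ := hlow p fun X =>
      (worstRatio_le_iff hB.le hb p _).mp hlt.le X (Set.mem_univ X)
    refine hlt.not_ge ?_
    calc ENNReal.ofReal b = costRatio (b * hindsightCost B X) (hindsightCost B X) :=
          (costRatio_mul_self hX).symm
      _ ≤ costRatio (expCost B p X) (hindsightCost B X) :=
          ENNReal.div_le_div_right (ENNReal.ofReal_le_ofReal hle) _
      _ ≤ worstRatio B p Set.univ :=
          le_iSup₂ (f := fun X (_ : X ∈ Set.univ) =>
            costRatio (expCost B p X) (hindsightCost B X)) X (Set.mem_univ X)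

theorem hindsightCost_goodThenBad {T k : ℕ} {B : ℝ} (hB : 0 ≤ B) (hk : k ≤ T) :
    hindsightCost B (goodThenBad T k) = min (k : ℝ) B := by
  rw [hindsightCost_eq hB, goods_goodThenBad hk]

theorem isTightValue_of_survival {T d : ℕ} {B b μ : ℝ} (hB : 1 < B) (hBT : B ≤ T) (hb : 1 ≤ b)
    (hd : d < T) (hdB : (d : ℝ) ≤ B) (hμB : μ ≤ B) (hμT : μ ≤ T - d) (hμ : B - 1 < μ)
    (hcase : μ = T - d ∨ μ = B ∧ B ≤ d + 1)
    (heq : b * d + μ * survival B b d = b * B) : IsTightValue T B b := by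
  have hB0 : 0 ≤ B := by linarith
  have key : ∀ p : RandAlg T, (∀ X, expCost B p X ≤ b * hindsightCost B X) →
      b * B ≤ goodCost B (contProb p fun _ => true) T ∧
        b ≤ goodCost B (contProb p fun _ => true) 1 := by
    intro p hp
    have hle : ∀ k ≤ T, goodCost B (contProb p fun _ => true) k ≤ b * min (k : ℝ) B := by
      intro k hk
      have h := (goodCost_le_expCost hk hB0 p).trans (hp (goodThenBad T k))
      rwa [hindsightCost_goodThenBad hB0 hk] at h
    have h := goodCost_lower_bound hB hd hμB hμT hμ heq (contProb_zero p _)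
      (contProb_antitone p _) (contProb_nonneg p _) fun k hk =>
        (hle k (by omega)).trans
          (mul_le_mul_of_nonneg_left (min_le_left _ _) (by linarith))
    exact ⟨h.1, h.2 ((hle T le_rfl).trans (le_of_eq (by rw [min_eq_right hBT])))⟩
  refine ⟨by linarith, gameValue_eq (by linarith) (by linarith)
    (exists_competitive hB hb hd hdB hμ hcase heq) fun p hp => ⟨goodThenBad T T, ?_, ?_⟩,
    fun p hp => ?_⟩
  · rw [hindsightCost_goodThenBad hB0 le_rfl, min_eq_right hBT]; linarith
  · rw [hindsightCost_goodThenBad hB0 le_rfl, min_eq_right hBT]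
    exact (key p hp).1.trans (goodCost_le_expCost le_rfl hB0 p)
  · rw [min_eq_left hB.le, mul_one]
    exact (key p hp).2.trans (goodCost_le_expCost (by omega) hB0 p)

theorem isTightValue_one {T : ℕ} {B : ℝ} (hB : 0 < B) (hBT : B ≤ T) (hB1 : B ≤ 1) :
    IsTightValue T B 1 := by
  have hT : 0 < T := by exact_mod_cast hB.trans_le hBT
  refine ⟨zero_le_one, gameValue_eq hB zero_le_one ⟨pureAlg (thresholdAlg 0), fun X => ?_⟩
    fun p _ => ⟨goodThenBad T T, ?_, ?_⟩, fun p _ => ?_⟩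
  · rw [expCost_pureAlg, cost_thresholdAlg, hindsightCost_eq hB.le, one_mul, thresholdCost]
    split_ifs with h
    · simp [Nat.le_zero.mp h, hB.le]
    · have : (1 : ℝ) ≤ goods X T := by exact_mod_cast (by omega : 1 ≤ goods X T)
      rw [min_eq_right (by linarith)]
      simp
  · rw [hindsightCost_goodThenBad hB.le le_rfl, min_eq_right hBT]; exact hB
  · rw [one_mul]; exact hindsightCost_le_expCost hB.le p _
  · have := hindsightCost_le_expCost hB.le p (goodThenBad T 1)
    rw [hindsightCost_goodThenBad hB.le hT] at this
    simpa using this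

/-- The parameter `a` is chosen so that `survival B b d = b * (1 - a)`, which turns the equation for
`b` into `μ * (1 - a) = B - d`. -/
theorem isTightValue_closed_form {T d : ℕ} {B μ a : ℝ} (hB : 1 < B) (hBT : B ≤ T)
    (hd : d < T) (hdB : (d : ℝ) < B) (hμB : μ ≤ B) (hμT : μ ≤ T - d) (hμ : B - 1 < μ)
    (hcase : μ = T - d ∨ μ = B ∧ B ≤ d + 1) (ha : 0 ≤ a) (heq : μ * (1 - a) = B - d) :
    IsTightValue T B (1 / (1 - a * ((B - 1) / B) ^ d)) := by
  have ha1 : a < 1 := by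
    have : 0 < μ * (1 - a) := by linarith
    have := (mul_pos_iff_of_pos_left (by linarith : 0 < μ)).mp this
    linarith
  have hρ0 : 0 < (B - 1) / B := div_pos (by linarith) (by linarith)
  have hρ1 : (B - 1) / B ≤ 1 := by rw [div_le_one (by linarith)]; linarith
  set u := ((B - 1) / B) ^ d with hu
  have hu0 : 0 < u := pow_pos hρ0 d
  have hu1 : u ≤ 1 := pow_le_one₀ hρ0.le hρ1
  have hau0 : 0 ≤ a * u := mul_nonneg ha hu0.le
  have hau : 0 < 1 - a * u := by
    have := mul_le_mul_of_nonneg_left hu1 ha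
    linarith
  have hru : (B / (B - 1)) ^ d * u = 1 := by
    rw [hu, ← mul_pow, div_mul_div_comm, mul_comm B, div_self, one_pow]
    exact (mul_pos (by linarith) (by linarith)).ne'
  set b := 1 / (1 - a * u) with hbdef
  have hb : b * (1 - a * u) = 1 := div_mul_cancel₀ _ hau.ne'
  have hsurv : survival B b d = b * (1 - a) := by
    unfold survival
    have : (b - 1) = b * a * u := by linarith
    rw [this]
    linear_combination (-(b * a)) * hru
  refine isTightValue_of_survival hB hBT ?_ hd hdB.le hμB hμT hμ hcase ?_
  · rw [hbdef, le_div_iff₀ hau]; linarith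
  · rw [hsurv]; linear_combination b * heq

theorem isTightValue_of_le {T : ℕ} {B : ℝ} (hB : 0 < B) (hBT : B ≤ T)
    (h : T + 1 ≤ ⌈B⌉₊ + ⌊B⌋₊) :
    IsTightValue T B
      (1 / (1 - ((T : ℝ) - B) / (⌊B⌋₊ : ℝ) * ((B - 1) / B) ^ (T - ⌊B⌋₊))) := by
  have hfT : ⌊B⌋₊ ≤ T := Nat.floor_le_of_le hBT
  have hcT : ⌈B⌉₊ ≤ T := Nat.ceil_le.mpr hBT
  have hfB : (⌊B⌋₊ : ℝ) ≤ B := Nat.floor_le hB.le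
  have hBf : B < ⌊B⌋₊ + 1 := Nat.lt_floor_add_one B
  have hf1 : 1 ≤ ⌊B⌋₊ := by omega
  have hf1' : (1 : ℝ) ≤ ⌊B⌋₊ := by exact_mod_cast hf1
  rcases le_or_gt B 1 with hB1 | hB1
  · have hc : ⌈B⌉₊ ≤ 1 := Nat.ceil_le.mpr (by simpa using hB1)
    -- Here `⌊B⌋₊ ≥ 1` leaves only `B = T = 1`, where the exponential recursion degenerates.
    obtain rfl : B = 1 := by linarith
    have hT : T = 1 := by simp at h; omega
    subst hT
    simpa using isTightValue_one hB hBT hB1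
  · have hdc : (((T - ⌊B⌋₊ : ℕ) : ℝ)) = T - ⌊B⌋₊ := Nat.cast_sub hfT
    refine isTightValue_closed_form (μ := ⌊B⌋₊) hB1 hBT (by omega)
      (Nat.lt_ceil.mp (by omega)) hfB (by rw [hdc]; linarith) (by linarith)
      (Or.inl (by rw [hdc]; ring)) (div_nonneg (by linarith) (by linarith)) ?_
    rw [hdc, mul_sub, mul_div_cancel₀ _ (by linarith)]
    ring

theorem isTightValue_of_lt {T : ℕ} {B : ℝ} (hB : 0 < B) (hBT : B ≤ T)
    (h : ⌈B⌉₊ + ⌊B⌋₊ < T + 1) :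
    IsTightValue T B (1 / (1 - ((⌈B⌉₊ : ℝ) - 1) / B * ((B - 1) / B) ^ (⌈B⌉₊ - 1))) := by
  have hc0 : 0 < ⌈B⌉₊ := Nat.ceil_pos.mpr hB
  have hBf : B < ⌊B⌋₊ + 1 := Nat.lt_floor_add_one B
  have hBc : B ≤ ⌈B⌉₊ := Nat.le_ceil B
  have hc1 : (1 : ℝ) ≤ ⌈B⌉₊ := by exact_mod_cast hc0
  rcases le_or_gt B 1 with hB1 | hB1
  · have hc : ⌈B⌉₊ = 1 := le_antisymm (Nat.ceil_le.mpr (by simpa using hB1)) hc0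
    simpa [hc] using isTightValue_one hB hBT hB1
  · have hdc : (((⌈B⌉₊ - 1 : ℕ) : ℝ)) = ⌈B⌉₊ - 1 := by
      rw [Nat.cast_sub hc0, Nat.cast_one]
    have h' : (⌈B⌉₊ : ℝ) + ⌊B⌋₊ ≤ T := by exact_mod_cast Nat.lt_succ_iff.mp h
    have hf0 : 0 < ⌊B⌋₊ := Nat.floor_pos.mpr hB1.le
    -- `d = ⌈B⌉₊ - 1` is the largest natural number below `B`; the case hypothesis yields `B ≤ T -
    -- d`.
    refine isTightValue_closed_form (μ := B) hB1 hBT (by omega)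
      (Nat.lt_ceil.mp (by omega)) le_rfl (by rw [hdc]; linarith) (by linarith)
      (Or.inr ⟨rfl, by rw [hdc]; linarith⟩) (div_nonneg (by linarith) hB.le) ?_
    rw [hdc, mul_sub, mul_div_cancel₀ _ hB.ne']
    ring

theorem exists_isTightValue {T : ℕ} {B : ℝ} (hB : 0 < B) (hBT : B ≤ T) :
    ∃ b, IsTightValue T B b := by
  rcases le_or_gt (T + 1) (⌈B⌉₊ + ⌊B⌋₊) with h | h
  · exact ⟨_, isTightValue_of_le hB hBT h⟩
  · exact ⟨_, isTightValue_of_lt hB hBT h⟩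

end SkiRental

theorem lemmal (T : ℕ) (B : ℝ) (hB : 0 < B) (hBT : B ≤ T) :
    (∀ WC SG : SkiRental.RandAlg T,
      SkiRental.IsWCOpt B WC → SkiRental.IsSubgameOptimal B SG →
        IsGreatest
          (Set.range fun X : SkiRental.Days T =>
            SkiRental.costRatio (SkiRental.expCost B WC X) (SkiRental.expCost B SG X))
          (SkiRental.gameValue T B)) ∧
    (T + 1 ≤ ⌈B⌉₊ + ⌊B⌋₊ →
      SkiRental.gameValue T B =
        ENNReal.ofReal
          (1 / (1 - ((T : ℝ) - B) / (⌊B⌋₊ : ℝ) * ((B - 1) / B) ^ (T - ⌊B⌋₊)))) ∧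
    (⌈B⌉₊ + ⌊B⌋₊ < T + 1 →
      SkiRental.gameValue T B =
        ENNReal.ofReal
          (1 / (1 - ((⌈B⌉₊ : ℝ) - 1) / B * ((B - 1) / B) ^ (⌈B⌉₊ - 1)))) := by
  refine ⟨fun WC SG hWC hSG => ?_, fun h => (SkiRental.isTightValue_of_le hB hBT h).2.1,
    fun h => (SkiRental.isTightValue_of_lt hB hBT h).2.1⟩
  obtain ⟨b, hb, hval, htight⟩ := SkiRental.exists_isTightValue hB hBT
  exact SkiRental.isGreatest_costRatio (by exact_mod_cast hB.trans_le hBT) hB hb hval htight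
    hWC hSG
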